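/- **Model.** An instance $\mathcal I=(E,\mathcal D,\mathcal F)$ consists of a finite set $E$ of elements, a distribution $D_e$ on the nonnegative reals for each $e\in E$, and a nonempty family $\mathcal F\subseteq 2^E$ of feasible sets. The elements arrive one by one in some order $\pi$ of $E$. When $e$ arrives, its identity is revealed and its value $v_e\sim D_e$ is drawn independently; a (possibly randomized) algorithm then decides irrevocably whether to select $e$, and the set selected in the end must belong to $\mathcal F$. The utility is the sum of the values of the selected elements, and $ALG(\pi)$ denotes the expected utility of the algorithm $ALG$ for the order $\pi$. An order-aware algorithm knows $\pi$ in advance; $OPT_{\mathcal I,\pi}(\pi)$ is the largest expected utility of an order-aware algorithm for $\pi$. An order-unaware algorithm does not know the order: its decisions depend only on the elements, values and decisions seen so far. Its order-competitive ratio is $$\rho(\mathcal I,ALG)=\min_{\pi}\frac{ALG(\pi)}{OPT_{\mathcal I,\pi}(\pi)},$$ the minimum being over all orders of $E$. **Theorem 5.1.** There is a constant $c>0$ such that: 1. For every integer $k\ge 1$ there is an instance $\mathcal I=(E,\mathcal D,\mathcal F)$ with $\mathcal F=\{S\subseteq E: |S|\le k\}$ (the $k$-uniform matroid constraint) and $0<OPT_{\mathcal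 I,\pi}(\pi)<\infty$ for all $\pi$, such that every order-unaware algorithm $ALG$ satisfies $$\rho(\mathcal I,ALG)\le 1-\frac{c}{\sqrt k}.$$ 2. For all sufficiently large $k$ the following instance has this property. Let $E=\{a_1,\dots,a_k,b_1,\dots,b_k,c_1,\dots,c_{2k}\}$ and $\mathcal F=\{S\subseteq E:|S|\le k\}$, where each $a_i$ has the deterministic value $7/4$, each $b_i$ has the deterministic value $1$, and each $c_i$ has the value $0$ or $2$ with probability $1/2$ each. Then $0<OPT_{\mathcal I,\pi}(\pi)<\infty$ for all $\pi$. Moreover, for the two orders $$\pi_1=(a_1,\dots,a_k,b_1,\dots,b_k,c_1,\dots,c_{2k}),\qquad \pi_2=(a_1,\dots,a_k,c_1,\dots,c_{2k},b_1,\dots,b_k),$$ every order-unaware algorithm $ALG$ satisfies $$\min_{j\in\{1,2\}}\frac{ALG(\pi_j)}{OPT_{\mathcal I,\pi_j}(\pi_j)}\le 1-\frac{c}{\sqrt k}.$$ -/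

import Mathlib

open scoped NNReal ENNReal

noncomputable section

/-- An arrival order of the elements of `E`: a list in which every element occurs exactly once. -/
structure ArrivalOrder (E : Type) where
  /-- The elements in the order in which they arrive. -/
  toList : List E
  nodup : toList.Nodup
  mem : ∀ e, e ∈ toList

/-- An instance `(E, D, F)`: the value of element `e` has law `D e` (a discrete law on the
nonnegative reals), and `F` is the nonempty family of feasible sets. -/
structure Instance (E : Type) where
  /-- The law of the value of each element. -/
  D : E → PMF ℝ≥0
  /-- The feasibility constraint. -/
  F : Set (Finset E)
  F_nonempty : F.Nonempty

/-- What has happened so far, oldest first: the elements that have arrived, with their values and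
with the decision taken (`true` means that the element was selected). -/
abbrev History (E : Type) : Type := List (E × ℝ≥0 × Bool)

/-- The set of selected elements. -/
def History.selected {E : Type} [DecidableEq E] (h : History E) : Finset E :=
  ((h.filter fun x => x.2.2).map fun x => x.1).toFinset

/-- The utility: the sum of the values of the selected elements. -/
def History.utility {E : Type} (h : History E) : ℝ≥0 :=
  (h.map fun x => if x.2.2 then x.2.1 else 0).sum

/-- A (deterministic or randomized) online algorithm: given the history, the identity of the
arriving element and its value, it selects the element with some probability. Its decisions never
refer to elements that have not arrived yet, nor to the order in which they will arrive. -/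
abbrev Algorithm (E : Type) : Type := History E → E → ℝ≥0 → PMF Bool

namespace Instance

variable {E : Type} (I : Instance E)

/-- The law of the final history when, after the history `h`, the elements of a list arrive in
the order of the list. Every value is drawn from the law of its element, independently of
everything before; then the algorithm decides. -/
def run (A : Algorithm E) : List E → History E → PMF (History E)
  | [], h => PMF.pure h
  | e :: l, h =>
      (I.D e).bind fun v => (A h e v).bind fun b => run A l (h ++ [(e, v, b)])

/-- The expected utility `ALG(π)` of the algorithm `A` for the arrival order `π`. -/
def expectedUtility (A : Algorithm E) (π : ArrivalOrder E) : ℝ≥0∞ :=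
  ∑' h : History E, I.run A π.toList [] h * (h.utility : ℝ≥0∞)

variable [DecidableEq E]

/-- For the arrival order `π`, the set selected by `A` is always feasible. -/
def IsFeasible (A : Algorithm E) (π : ArrivalOrder E) : Prop :=
  ∀ h ∈ (I.run A π.toList []).support, History.selected h ∈ I.F

/-- An order-unaware algorithm for the instance: one and the same algorithm is used for all
arrival orders, and it has to respect the feasibility constraint for each of them. -/
def IsOrderUnaware (A : Algorithm E) : Prop :=
  ∀ π : ArrivalOrder E, I.IsFeasible A π

/-- The expected utility of the best order-aware algorithm for `π`: the algorithm may be chosen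
depending on `π`, and has to respect the feasibility constraint for `π`. -/
def opt (π : ArrivalOrder E) : ℝ≥0∞ :=
  ⨆ (A : Algorithm E) (_ : I.IsFeasible A π), I.expectedUtility A π

/-- The ratio `ALG(π) / OPT_π(π)`. -/
def ratio (A : Algorithm E) (π : ArrivalOrder E) : ℝ≥0∞ :=
  I.expectedUtility A π / I.opt π

/-- The order-competitive ratio of `A` on the instance. -/
def orderCompetitiveRatio (A : Algorithm E) : ℝ≥0∞ :=
  ⨅ π : ArrivalOrder E, I.ratio A π

/-- The optimum is positive and finite for every arrival order, so that all the ratios above are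
genuine quotients. -/
def NonDegenerate : Prop :=
  ∀ π : ArrivalOrder E, 0 < I.opt π ∧ I.opt π < ⊤

end Instance

/-- The independent sets of the `k`-uniform matroid on `E`. -/
def uniformConstraint (E : Type) (k : ℕ) : Set (Finset E) := {S | S.card ≤ k}

/-- The elements `a₁, …, a_k` (left summand), `b₁, …, b_k` and `c₁, …, c_{2k}`. -/
abbrev HardElement (k : ℕ) : Type := Fin k ⊕ (Fin k ⊕ Fin (2 * k))

/-- Each `aᵢ` has value `7/4`, each `bᵢ` has value `1`, each `cᵢ` is a fair coin on `{0, 2}`. -/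
def hardInstance (k : ℕ) : Instance (HardElement k) where
  D
    | .inl _ => PMF.pure (7 / 4)
    | .inr (.inl _) => PMF.pure 1
    | .inr (.inr _) => PMF.uniformOfFinset {0, 2} (Finset.insert_nonempty _ _)
  F := uniformConstraint (HardElement k) k
  F_nonempty := ⟨∅, by simp [uniformConstraint]⟩

/-- `a₁, …, a_k` in this order. -/
def listA (k : ℕ) : List (HardElement k) := (List.finRange k).map Sum.inl

/-- `b₁, …, b_k` in this order. -/
def listB (k : ℕ) : List (HardElement k) := (List.finRange k).map fun i => Sum.inr (Sum.inl i)

/-- `c₁, …, c_{2k}` in this order. -/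
def listC (k : ℕ) : List (HardElement k) :=
  (List.finRange (2 * k)).map fun i => Sum.inr (Sum.inr i)

theorem nodup_listA_append_listB_append_listC (k : ℕ) :
    (listA k ++ (listB k ++ listC k)).Nodup := by
  have hA : (listA k).Nodup := (List.nodup_finRange k).map Sum.inl_injective
  have hB : (listB k).Nodup :=
    (List.nodup_finRange k).map (Sum.inr_injective.comp Sum.inl_injective)
  have hC : (listC k).Nodup :=
    (List.nodup_finRange (2 * k)).map (Sum.inr_injective.comp Sum.inr_injective)
  refine hA.append (hB.append hC ?_) ?_
  · intro x hx hy
    simp only [listB, listC, List.mem_map] at hx hy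
    obtain ⟨i, -, rfl⟩ := hx
    obtain ⟨j, -, hj⟩ := hy
    simp at hj
  · intro x hx hy
    simp only [listA, listB, listC, List.mem_append, List.mem_map] at hx hy
    obtain ⟨i, -, rfl⟩ := hx
    rcases hy with ⟨j, -, hj⟩ | ⟨j, -, hj⟩ <;> simp at hj

/-- The order in which the `a`'s arrive first, then the `b`'s, then the `c`'s. -/
def orderABC (k : ℕ) : ArrivalOrder (HardElement k) where
  toList := listA k ++ (listB k ++ listC k)
  nodup := nodup_listA_append_listB_append_listC k
  mem := by rintro (i | i | i) <;> simp [listA, listB, listC]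

/-- The order in which the `a`'s arrive first, then the `c`'s, then the `b`'s. -/
def orderACB (k : ℕ) : ArrivalOrder (HardElement k) where
  toList := listA k ++ (listC k ++ listB k)
  nodup := ((List.perm_append_comm).append_left (listA k)).nodup
    (nodup_listA_append_listB_append_listC k)
  mem := by rintro (i | i | i) <;> simp [listA, listB, listC]

end

/-! Both orders of the hard instance begin with the same `a`'s, so an order-unaware algorithm leaves
a number `m` of free slots after them whose law is the same for both. The two continuations want
different `m`, and no single choice suits both.

Under a uniform constraint the optimum is a dynamic program in the number of free slots
(`opt_eq_slotValue`). Let `T i` be the probability of at least `i` heads in `2k` fair tosses. If the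
`b`'s precede the `c`'s, the `b`'s are useless for `m ≤ k`, and the `m`-th slot is worth `2 T m`. If
the `b`'s come last they are a fallback worth `1` per slot, and the `m`-th slot is worth `1 + T m`.
A slot costs `7/4`, so the first order wants slots while `T m ≥ 7/8`, the second while `T m ≥ 3/4`.
Each step of `T` is at most the central binomial probability, hence at most `1/√(2k+1)`, so there
are order `√k` slots with `T` strictly between these thresholds. Each costs a constant in one order
or the other (`exists_better_slots`). The additive loss of order `√k` against optima of at most `2k`
gives a relative loss of order `1/√k` (`min_div_le`).

For `k ≤ 1024` any loss of order `1/k` suffices, and one `b` and one `c` already force it. -/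

open scoped NNReal ENNReal

noncomputable section

/-! ### Expectations of discrete laws -/

namespace PMF

variable {α β : Type*}

/-- The expectation of a nonnegative function of a discrete random variable. -/
def expect (p : PMF α) (f : α → ℝ≥0∞) : ℝ≥0∞ := ∑' x, p x * f x

@[simp]
theorem expect_pure (a : α) (f : α → ℝ≥0∞) : (PMF.pure a).expect f = f a := by
  rw [expect, tsum_eq_single a]
  · simp
  · intro b hb
    simp [hb]

theorem expect_bind (p : PMF α) (q : α → PMF β) (f : β → ℝ≥0∞) :
    (p.bind q).expect f = p.expect fun a => (q a).expect f := by
  simp only [expect, bind_apply, ← ENNReal.tsum_mul_right, ← ENNReal.tsum_mul_left]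
  rw [ENNReal.tsum_comm]
  simp only [mul_assoc]

theorem expect_mono {p : PMF α} {f g : α → ℝ≥0∞} (h : ∀ a ∈ p.support, f a ≤ g a) :
    p.expect f ≤ p.expect g := by
  refine ENNReal.tsum_le_tsum fun a => ?_
  by_cases ha : p a = 0
  · simp [ha]
  · gcongr
    exact h a ((p.mem_support_iff a).2 ha)

@[simp]
theorem expect_const (p : PMF α) (c : ℝ≥0∞) : (p.expect fun _ => c) = c := by
  rw [expect, ENNReal.tsum_mul_right, p.tsum_coe, one_mul]

theorem expect_add (p : PMF α) (f g : α → ℝ≥0∞) :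
    (p.expect fun a => f a + g a) = p.expect f + p.expect g := by
  simp only [expect, mul_add, ENNReal.tsum_add]

theorem expect_le_of_forall {p : PMF α} {f : α → ℝ≥0∞} {c : ℝ≥0∞}
    (h : ∀ a ∈ p.support, f a ≤ c) : p.expect f ≤ c :=
  (expect_mono h).trans_eq (p.expect_const c)

theorem le_expect_of_forall {p : PMF α} {f : α → ℝ≥0∞} {c : ℝ≥0∞}
    (h : ∀ a ∈ p.support, c ≤ f a) : c ≤ p.expect f :=
  (p.expect_const c).symm.trans_le (expect_mono h)

end PMF

/-- The value of a fair coin with the outcomes `0` and `2`. -/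
def fairCoin : PMF ℝ≥0 := PMF.uniformOfFinset {0, 2} (Finset.insert_nonempty _ _)

theorem expect_fairCoin (f : ℝ≥0 → ℝ≥0∞) :
    fairCoin.expect f = 2⁻¹ * f 0 + 2⁻¹ * f 2 := by
  have h2 : (({0, 2} : Finset ℝ≥0).card) = 2 := Finset.card_pair (by norm_num)
  rw [PMF.expect, tsum_eq_sum (s := {0, 2})]
  · rw [Finset.sum_pair (by norm_num)]
    simp [fairCoin, PMF.uniformOfFinset_apply, h2]
  · intro b hb
    simp [fairCoin, PMF.uniformOfFinset_apply, hb]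

/-! ### The dynamic program in the number of free slots -/

/-- The optimal expected utility when elements with the given laws arrive in this order and at
most `m` of them may be selected. -/
def slotValue : List (PMF ℝ≥0) → ℕ → ℝ≥0∞
  | [], _ => 0
  | _ :: _, 0 => 0
  | p :: l, m + 1 => p.expect fun v => max (slotValue l (m + 1)) (v + slotValue l m)

@[simp]
theorem slotValue_nil (m : ℕ) : slotValue [] m = 0 := by cases m <;> rfl

@[simp]
theorem slotValue_zero (l : List (PMF ℝ≥0)) : slotValue l 0 = 0 := by cases l <;> rfl

theorem slotValue_cons_succ (p : PMF ℝ≥0) (l : List (PMF ℝ≥0)) (m : ℕ) :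
    slotValue (p :: l) (m + 1) =
      p.expect fun v => max (slotValue l (m + 1)) (v + slotValue l m) := rfl

theorem slotValue_pure_cons_succ (x : ℝ≥0) (l : List (PMF ℝ≥0)) (m : ℕ) :
    slotValue (PMF.pure x :: l) (m + 1) = max (slotValue l (m + 1)) (x + slotValue l m) := by
  rw [slotValue_cons_succ, PMF.expect_pure]

theorem slotValue_fairCoin_cons_succ (l : List (PMF ℝ≥0)) (m : ℕ) :
    slotValue (fairCoin :: l) (m + 1) =
      2⁻¹ * max (slotValue l (m + 1)) (slotValue l m) +
        2⁻¹ * max (slotValue l (m + 1)) (2 + slotValue l m) := by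
  rw [slotValue_cons_succ, expect_fairCoin]
  simp

theorem slotValue_le_cons (p : PMF ℝ≥0) (l : List (PMF ℝ≥0)) (m : ℕ) :
    slotValue l m ≤ slotValue (p :: l) m := by
  cases m with
  | zero => simp
  | succ m => exact PMF.le_expect_of_forall fun v _ => le_max_left _ _

theorem slotValue_le_append (l₁ l₂ : List (PMF ℝ≥0)) (m : ℕ) :
    slotValue l₂ m ≤ slotValue (l₁ ++ l₂) m := by
  induction l₁ with
  | nil => rfl
  | cons p l ih => exact ih.trans (slotValue_le_cons p _ m)

theorem slotValue_le_mul (B : ℝ≥0) (l : List (PMF ℝ≥0))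
    (hl : ∀ p ∈ l, ∀ v ∈ p.support, v ≤ B) (m : ℕ) : slotValue l m ≤ B * m := by
  induction l generalizing m with
  | nil => simp
  | cons p l ih =>
    cases m with
    | zero => simp
    | succ m =>
      have ih' := ih fun q hq => hl q (List.mem_cons_of_mem _ hq)
      refine PMF.expect_le_of_forall fun v hv => max_le (ih' _) ?_
      have hv' : (v : ℝ≥0∞) ≤ B := by exact_mod_cast hl p List.mem_cons_self v hv
      calc (v : ℝ≥0∞) + slotValue l m ≤ B + B * m := add_le_add hv' (ih' m)
        _ = B * (m + 1 : ℕ) := by push_cast; ring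

theorem le_slotValue_of_mem {x : ℝ≥0} {l : List (PMF ℝ≥0)} (hx : PMF.pure x ∈ l) {m : ℕ}
    (hm : 1 ≤ m) : (x : ℝ≥0∞) ≤ slotValue l m := by
  obtain ⟨l₁, l₂, rfl⟩ := List.append_of_mem hx
  refine le_trans ?_ (slotValue_le_append l₁ _ m)
  obtain ⟨m, rfl⟩ := Nat.exists_eq_add_of_le' hm
  rw [slotValue_pure_cons_succ]
  exact le_max_of_le_right le_self_add

/-- Selecting the first `j` copies of `x` and none of the others is one admissible strategy. -/
theorem mul_add_slotValue_le (x : ℝ≥0) (l : List (PMF ℝ≥0)) {j n m : ℕ} (hn : j ≤ n)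
    (hm : j ≤ m) :
    (x * j : ℝ≥0∞) + slotValue l (m - j) ≤ slotValue (List.replicate n (PMF.pure x) ++ l) m := by
  induction j generalizing n m with
  | zero => simpa using slotValue_le_append _ l m
  | succ j ih =>
    obtain ⟨n, rfl⟩ := Nat.exists_eq_add_of_le' (Nat.one_le_of_lt hn)
    obtain ⟨m, rfl⟩ := Nat.exists_eq_add_of_le' (Nat.one_le_of_lt hm)
    rw [List.replicate_succ, List.cons_append, slotValue_pure_cons_succ]
    refine le_max_of_le_right ?_
    have := ih (n := n) (m := m) (by omega) (by omega)
    rw [Nat.add_sub_add_right]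
    calc (x * (j + 1 : ℕ) : ℝ≥0∞) + slotValue l (m - j)
        = x + (x * j + slotValue l (m - j)) := by push_cast; ring
      _ ≤ _ := by gcongr

/-! ### Bookkeeping for histories -/

namespace History

variable {E : Type}

theorem utility_concat (h : History E) (e : E) (v : ℝ≥0) (b : Bool) :
    utility (h ++ [(e, v, b)]) = h.utility + if b then v else 0 := by
  simp [utility]

variable [DecidableEq E]

theorem selected_concat_true (h : History E) (e : E) (v : ℝ≥0) :
    selected (h ++ [(e, v, true)]) = insert e h.selected := by
  ext a
  simp [selected]

theorem selected_concat_false (h : History E) (e : E) (v : ℝ≥0) :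
    selected (h ++ [(e, v, false)]) = h.selected := by
  simp [selected]

theorem selected_subset_concat (h : History E) (e : E) (v : ℝ≥0) (b : Bool) :
    h.selected ⊆ selected (h ++ [(e, v, b)]) := by
  cases b
  · rw [selected_concat_false]
  · rw [selected_concat_true]
    exact Finset.subset_insert _ _

theorem card_selected_concat_true {h : History E} {e : E} {l : List E}
    (hn : (h.map Prod.fst ++ e :: l).Nodup) (v : ℝ≥0) :
    (selected (h ++ [(e, v, true)])).card = h.selected.card + 1 := by
  rw [selected_concat_true, Finset.card_insert_of_notMem]
  intro he
  have he' : e ∈ h.map Prod.fst := by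
    simp only [selected, List.mem_toFinset, List.mem_map, List.mem_filter] at he ⊢
    obtain ⟨x, hx, rfl⟩ := he
    exact ⟨x, hx.1, rfl⟩
  exact (List.nodup_append.1 hn).2.2 e he' e List.mem_cons_self rfl

end History

/-! ### The optimum under a uniform constraint, and orders with a common prefix -/

namespace Instance

variable {E : Type} (I : Instance E)

theorem expectedUtility_eq_expect (A : Algorithm E) (π : ArrivalOrder E) :
    I.expectedUtility A π = (I.run A π.toList []).expect fun h => h.utility := rfl

theorem run_append (A : Algorithm E) (l₁ l₂ : List E) (h : History E) :
    I.run A (l₁ ++ l₂) h = (I.run A l₁ h).bind (I.run A l₂) := by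
  induction l₁ generalizing h with
  | nil => simp [run]
  | cons e l ih => simp [run, ih]

theorem mem_support_run_cons {A : Algorithm E} {e : E} {l : List E} {h h' : History E} :
    h' ∈ (I.run A (e :: l) h).support ↔ ∃ v ∈ (I.D e).support, ∃ b ∈ (A h e v).support,
      h' ∈ (I.run A l (h ++ [(e, v, b)])).support := by
  simp [run]

theorem expect_run_cons (A : Algorithm E) (e : E) (l : List E) (h : History E)
    (f : History E → ℝ≥0∞) :
    (I.run A (e :: l) h).expect f = (I.D e).expect fun v => (A h e v).expect fun b =>
      (I.run A l (h ++ [(e, v, b)])).expect f := by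
  simp only [run, PMF.expect_bind]

theorem nodup_concat {e : E} {l : List E} {h : History E}
    (hn : (h.map Prod.fst ++ e :: l).Nodup) (v : ℝ≥0) (b : Bool) :
    ((h ++ [(e, v, b)]).map Prod.fst ++ l).Nodup := by
  simpa using hn

theorem nodup_map_nil_append (π : ArrivalOrder E) :
    (([] : History E).map Prod.fst ++ π.toList).Nodup := by
  simpa using π.nodup

theorem map_fst_of_mem_support_run {A : Algorithm E} {l : List E} {h h' : History E}
    (hh : h' ∈ (I.run A l h).support) : h'.map Prod.fst = h.map Prod.fst ++ l := by
  induction l generalizing h with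
  | nil =>
    simp only [run, PMF.support_pure, Set.mem_singleton_iff] at hh
    simp [hh]
  | cons e l ih =>
    obtain ⟨v, -, b, -, hh⟩ := (I.mem_support_run_cons).1 hh
    simpa using ih hh

variable [DecidableEq E]

theorem selected_subset_of_mem_support_run {A : Algorithm E} {l : List E} {h h' : History E}
    (hh : h' ∈ (I.run A l h).support) : h.selected ⊆ h'.selected := by
  induction l generalizing h with
  | nil =>
    simp only [run, PMF.support_pure, Set.mem_singleton_iff] at hh
    simp [hh]
  | cons e l ih =>
    obtain ⟨v, -, b, -, hh⟩ := (I.mem_support_run_cons).1 hh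
    exact (h.selected_subset_concat e v b).trans (ih hh)

theorem card_selected_le_of_forall {A : Algorithm E} {l : List E} {h : History E} {k : ℕ}
    (hf : ∀ h' ∈ (I.run A l h).support, h'.selected.card ≤ k) : h.selected.card ≤ k := by
  obtain ⟨h', hh⟩ := (I.run A l h).support_nonempty
  exact (Finset.card_le_card (I.selected_subset_of_mem_support_run hh)).trans (hf h' hh)

/-- No algorithm that selects at most `k` elements beats the dynamic program. -/
theorem expect_utility_run_le {A : Algorithm E} {k : ℕ} {l : List E} {h : History E}
    (hn : (h.map Prod.fst ++ l).Nodup)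
    (hf : ∀ h' ∈ (I.run A l h).support, h'.selected.card ≤ k) :
    ((I.run A l h).expect fun h' => h'.utility) ≤
      h.utility + slotValue (l.map I.D) (k - h.selected.card) := by
  induction l generalizing h with
  | nil => simp [run]
  | cons e l ih =>
    have key : ∀ v ∈ (I.D e).support, ∀ b ∈ (A h e v).support,
        ((I.run A l (h ++ [(e, v, b)])).expect fun h' => h'.utility) ≤
          History.utility (h ++ [(e, v, b)]) +
            slotValue (l.map I.D) (k - (History.selected (h ++ [(e, v, b)])).card) ∧
        (History.selected (h ++ [(e, v, b)])).card ≤ k := by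
      intro v hv b hb
      have hf' : ∀ h' ∈ (I.run A l (h ++ [(e, v, b)])).support, h'.selected.card ≤ k :=
        fun h' hh => hf h' ((I.mem_support_run_cons).2 ⟨v, hv, b, hb, hh⟩)
      exact ⟨ih (nodup_concat hn v b) hf', I.card_selected_le_of_forall hf'⟩
    rw [expect_run_cons]
    -- With no free slot, a positive probability of selecting `e` would contradict feasibility, so
    -- only `b = false` survives.
    rcases hm : k - h.selected.card with _ | m
    · refine PMF.expect_le_of_forall fun v hv => PMF.expect_le_of_forall fun b hb => ?_
      obtain ⟨h₁, h₂⟩ := key v hv b hb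
      cases b
      · simpa [History.utility_concat, History.selected_concat_false, hm] using h₁
      · rw [History.card_selected_concat_true hn] at h₂
        omega
    · rw [List.map_cons, slotValue_cons_succ, ← PMF.expect_const (I.D e) (h.utility : ℝ≥0∞),
        ← PMF.expect_add]
      refine PMF.expect_mono fun v hv => PMF.expect_le_of_forall fun b hb => ?_
      obtain ⟨h₁, h₂⟩ := key v hv b hb
      refine h₁.trans ?_
      cases b
      · rw [History.selected_concat_false, History.utility_concat, hm]
        simp
      · have hm' : k - (h.selected.card + 1) = m := by omega
        rw [History.card_selected_concat_true hn, History.utility_concat, hm']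
        simp only [if_true, ENNReal.coe_add, add_assoc]
        gcongr
        exact le_max_right _ _

/-- The algorithm that follows the dynamic program for the order `L` with `k` slots. -/
def greedyAlgorithm (L : List E) (k : ℕ) : Algorithm E := fun h _ v =>
  open scoped Classical in
  PMF.pure (decide (h.selected.card < k ∧
    slotValue ((L.drop (h.length + 1)).map I.D) (k - h.selected.card) ≤
      v + slotValue ((L.drop (h.length + 1)).map I.D) (k - h.selected.card - 1)))

theorem card_selected_greedyAlgorithm_le {L : List E} {k : ℕ} {l : List E} {h h' : History E}
    (hn : (h.map Prod.fst ++ l).Nodup) (hk : h.selected.card ≤ k)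
    (hh : h' ∈ (I.run (I.greedyAlgorithm L k) l h).support) : h'.selected.card ≤ k := by
  induction l generalizing h with
  | nil =>
    simp only [run, PMF.support_pure, Set.mem_singleton_iff] at hh
    exact hh ▸ hk
  | cons e l ih =>
    obtain ⟨v, -, b, hb, hh⟩ := (I.mem_support_run_cons).1 hh
    refine ih (nodup_concat hn v b) ?_ hh
    cases b
    · rwa [History.selected_concat_false]
    · rw [History.card_selected_concat_true hn]
      simp only [greedyAlgorithm, PMF.support_pure, Set.mem_singleton_iff] at hb
      exact (of_decide_eq_true hb.symm).1

/-- The algorithm reads its position in `L` off the length of the history; `hL` says that this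
position is the right one. Its test is then exactly the maximum in the recursion of `slotValue`. -/
theorem expect_utility_greedyAlgorithm {L : List E} {k : ℕ} {l : List E} {h : History E}
    (hn : (h.map Prod.fst ++ l).Nodup) (hk : h.selected.card ≤ k) (hL : L.drop h.length = l) :
    ((I.run (I.greedyAlgorithm L k) l h).expect fun h' => h'.utility) =
      h.utility + slotValue (l.map I.D) (k - h.selected.card) := by
  induction l generalizing h with
  | nil => simp [run]
  | cons e l ih =>
    have hL' : L.drop (h.length + 1) = l := by
      rw [← List.drop_drop, hL, List.drop_one, List.tail_cons]
    have hrun : ∀ v b, (History.selected (h ++ [(e, v, b)])).card ≤ k →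
        ((I.run (I.greedyAlgorithm L k) l (h ++ [(e, v, b)])).expect fun h' => h'.utility) =
          History.utility (h ++ [(e, v, b)]) +
            slotValue (l.map I.D) (k - (History.selected (h ++ [(e, v, b)])).card) :=
      fun v b hb => ih (nodup_concat hn v b) hb (by simpa using hL')
    rw [expect_run_cons]
    simp only [greedyAlgorithm, PMF.expect_pure, hL']
    rcases hm : k - h.selected.card with _ | m
    · have hlt : ¬ h.selected.card < k := by omega
      simp only [hlt, false_and, decide_false]
      change (I.D e).expect (fun v =>
        (I.run (I.greedyAlgorithm L k) l (h ++ [(e, v, false)])).expect _) = _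
      simp [hrun _ false ((h.selected_concat_false e _).symm ▸ hk), History.utility_concat,
        History.selected_concat_false, hm]
    · have hlt : h.selected.card < k := by omega
      have hm' : k - (h.selected.card + 1) = m := by omega
      rw [List.map_cons, slotValue_cons_succ, ← PMF.expect_const (I.D e) (h.utility : ℝ≥0∞),
        ← PMF.expect_add]
      congr 1
      funext v
      by_cases hv : slotValue (l.map I.D) (m + 1) ≤ v + slotValue (l.map I.D) m
      · simp only [hlt, Nat.add_sub_cancel, hv, and_self, decide_true]
        rw [hrun v true (by rw [History.card_selected_concat_true hn]; omega),
          History.card_selected_concat_true hn, hm', History.utility_concat, max_eq_right hv]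
        simp [add_assoc]
      · simp only [hlt, Nat.add_sub_cancel, hv, and_false, decide_false]
        rw [hrun v false ((h.selected_concat_false e _).symm ▸ hk),
          History.selected_concat_false, hm, History.utility_concat,
          max_eq_left (le_of_not_ge hv)]
        simp

/-- Under a uniform matroid constraint the optimum is the value of the dynamic program. -/
theorem opt_eq_slotValue {k : ℕ} (hF : I.F = uniformConstraint E k) (π : ArrivalOrder E) :
    I.opt π = slotValue (π.toList.map I.D) k := by
  have h0 : (History.selected ([] : History E)).card = 0 := rfl
  have h1 : History.utility ([] : History E) = 0 := rfl
  apply le_antisymm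
  · refine iSup₂_le fun A hA => ?_
    have hf : ∀ h' ∈ (I.run A π.toList []).support, h'.selected.card ≤ k := fun h' hh => by
      have := hA h' hh
      rwa [hF] at this
    simpa [expectedUtility_eq_expect, h0, h1] using
      I.expect_utility_run_le (nodup_map_nil_append π) hf
  · refine le_iSup₂_of_le (I.greedyAlgorithm π.toList k) (fun h hh => ?_) ?_
    · rw [hF]
      exact I.card_selected_greedyAlgorithm_le (nodup_map_nil_append π) (by simp [h0]) hh
    · have := I.expect_utility_greedyAlgorithm (L := π.toList) (k := k)
        (nodup_map_nil_append π) (by simp [h0]) rfl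
      rw [expectedUtility_eq_expect, this]
      simp [h0, h1]

theorem opt_le_mul {k : ℕ} (hF : I.F = uniformConstraint E k) {B : ℝ≥0}
    (hB : ∀ e, ∀ v ∈ (I.D e).support, v ≤ B) (π : ArrivalOrder E) : I.opt π ≤ B * k := by
  rw [I.opt_eq_slotValue hF]
  refine slotValue_le_mul B _ (fun p hp => ?_) k
  obtain ⟨e, -, rfl⟩ := List.mem_map.1 hp
  exact hB e

theorem utility_eq_of_mem_support_run {A : Algorithm E} {x : ℝ≥0} {l : List E}
    {h h' : History E} (hn : (h.map Prod.fst ++ l).Nodup) (hD : ∀ e ∈ l, I.D e = PMF.pure x)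
    (hu : h.utility = x * h.selected.card) (hh : h' ∈ (I.run A l h).support) :
    h'.utility = x * h'.selected.card := by
  induction l generalizing h with
  | nil =>
    simp only [run, PMF.support_pure, Set.mem_singleton_iff] at hh
    exact hh ▸ hu
  | cons e l ih =>
    obtain ⟨v, hv, b, -, hh⟩ := (I.mem_support_run_cons).1 hh
    refine ih (nodup_concat hn v b) (fun e' he => hD e' (List.mem_cons_of_mem _ he)) ?_ hh
    rw [hD e List.mem_cons_self, PMF.support_pure, Set.mem_singleton_iff] at hv
    cases b
    · simp [History.selected_concat_false, History.utility_concat, hu]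
    · rw [History.card_selected_concat_true hn, History.utility_concat, hu, hv]
      push_cast
      simp [mul_add]

/-- Condition on the history after `l₁` and bound what follows by the dynamic program. -/
theorem expectedUtility_append_le {A : Algorithm E} {k : ℕ} (hF : I.F = uniformConstraint E k)
    {π : ArrivalOrder E} (hA : I.IsFeasible A π) {l₁ l₂ : List E} (hπ : π.toList = l₁ ++ l₂) :
    I.expectedUtility A π ≤ (I.run A l₁ []).expect fun h =>
      h.utility + slotValue (l₂.map I.D) (k - h.selected.card) := by
  rw [expectedUtility_eq_expect, hπ, run_append, PMF.expect_bind]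
  refine PMF.expect_mono fun h hh => I.expect_utility_run_le ?_ fun h' hh' => ?_
  · rw [I.map_fst_of_mem_support_run hh]
    simpa [← hπ] using π.nodup
  · have := hA h' (by rw [hπ, run_append]; exact (PMF.mem_support_bind_iff _ _ _).2 ⟨h, hh, hh'⟩)
    rwa [hF] at this

/-- Two orders share an initial segment of elements of the same deterministic value `x`. The
number `k - m` of elements selected there is the same for both orders, so a loss incurred for
every `m` is a loss for the algorithm. -/
theorem expectedUtility_add_le {A : Algorithm E} {k : ℕ} (hF : I.F = uniformConstraint E k)
    {π₁ π₂ : ArrivalOrder E} (hA : I.IsOrderUnaware A) {l l₁ l₂ : List E}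
    (h₁ : π₁.toList = l ++ l₁) (h₂ : π₂.toList = l ++ l₂) {x : ℝ≥0}
    (hD : ∀ e ∈ l, I.D e = PMF.pure x) {δ C : ℝ≥0∞}
    (hδ : ∀ s m : ℕ, s + m = k →
      2 * (x * s : ℝ≥0∞) + slotValue (l₁.map I.D) m + slotValue (l₂.map I.D) m + δ ≤ C) :
    I.expectedUtility A π₁ + I.expectedUtility A π₂ + δ ≤ C := by
  -- Both bounds are expectations over the same law `I.run A l []`, so they can be added under one
  -- expectation and compared history by history.
  refine (add_le_add_left (add_le_add (I.expectedUtility_append_le hF (hA π₁) h₁)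
    (I.expectedUtility_append_le hF (hA π₂) h₂)) δ).trans ?_
  rw [← PMF.expect_add, ← PMF.expect_const (I.run A l []) δ, ← PMF.expect_add]
  refine PMF.expect_le_of_forall fun h hh => ?_
  have hn : (([] : History E).map Prod.fst ++ l).Nodup := by
    have := π₁.nodup
    rw [h₁] at this
    simpa using (List.nodup_append.1 this).1
  have hu := I.utility_eq_of_mem_support_run hn hD (by simp [History.utility, History.selected]) hh
  have hk : h.selected.card ≤ k := by
    refine I.card_selected_le_of_forall (A := A) (l := l₁) fun h' hh' => ?_
    have := hA π₁ h' (by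
      rw [h₁, run_append]; exact (PMF.mem_support_bind_iff _ _ _).2 ⟨h, hh, hh'⟩)
    rwa [hF] at this
  refine le_trans (le_of_eq ?_) (hδ h.selected.card (k - h.selected.card) (by omega))
  rw [hu]
  push_cast
  ring

theorem nonDegenerate_of_uniform {k : ℕ} (hk : 1 ≤ k) (hF : I.F = uniformConstraint E k)
    {B x : ℝ≥0} (hB : ∀ e, ∀ v ∈ (I.D e).support, v ≤ B) (hx : 0 < x) {e : E}
    (he : I.D e = PMF.pure x) : I.NonDegenerate := by
  intro π
  constructor
  · rw [I.opt_eq_slotValue hF]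
    refine lt_of_lt_of_le (ENNReal.coe_pos.2 hx) (le_slotValue_of_mem ?_ hk)
    exact List.mem_map.2 ⟨e, π.mem e, he⟩
  · exact (I.opt_le_mul hF hB π).trans_lt
      (ENNReal.mul_lt_top ENNReal.coe_lt_top (ENNReal.natCast_lt_top k))

end Instance

/-! ### From an additive loss to a ratio -/

/-- If both ratios exceeded `1 - δ / (2B)`, summing would give a total loss below `δ / (2B) * (o₁ +
o₂) ≤ δ`. -/
theorem min_div_le {a₁ a₂ o₁ o₂ : ℝ≥0∞} {δ B : ℝ≥0} (hB : 0 < B) (h₁ : 0 < o₁) (h₂ : 0 < o₂)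
    (h₁B : o₁ ≤ B) (h₂B : o₂ ≤ B) (h : a₁ + a₂ + δ ≤ o₁ + o₂) :
    min (a₁ / o₁) (a₂ / o₂) ≤ ENNReal.ofReal (1 - δ / (2 * B)) := by
  by_contra! hlt
  have t₁ : o₁ ≠ ⊤ := (h₁B.trans_lt ENNReal.coe_lt_top).ne
  have t₂ : o₂ ≠ ⊤ := (h₂B.trans_lt ENNReal.coe_lt_top).ne
  obtain ⟨l₁, l₂⟩ := lt_min_iff.1 hlt
  rw [ENNReal.lt_div_iff_mul_lt (Or.inl h₁.ne') (Or.inl t₁)] at l₁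
  rw [ENNReal.lt_div_iff_mul_lt (Or.inl h₂.ne') (Or.inl t₂)] at l₂
  have hsum : a₁ + a₂ + δ ≠ ⊤ := (h.trans_lt (ENNReal.add_lt_top.2 ⟨t₁.lt_top, t₂.lt_top⟩)).ne
  have s₁ : a₁ ≠ ⊤ := by rintro rfl; simp at hsum
  have s₂ : a₂ ≠ ⊤ := by rintro rfl; simp at hsum
  lift o₁ to ℝ≥0 using t₁
  lift o₂ to ℝ≥0 using t₂
  lift a₁ to ℝ≥0 using s₁
  lift a₂ to ℝ≥0 using s₂
  rw [ENNReal.ofReal, ← ENNReal.coe_mul, ENNReal.coe_lt_coe, ← NNReal.coe_lt_coe,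
    NNReal.coe_mul] at l₁ l₂
  have hc := Real.le_coe_toNNReal (1 - (δ : ℝ) / (2 * B))
  set r : ℝ := (Real.toNNReal (1 - (δ : ℝ) / (2 * B)) : ℝ)
  norm_cast at h h₁B h₂B
  rw [← NNReal.coe_le_coe] at h h₁B h₂B
  push_cast at h
  have hB' : (0 : ℝ) < B := hB
  have e₁ : (1 - (δ : ℝ) / (2 * B)) * o₁ ≤ r * o₁ := by gcongr
  have e₂ : (1 - (δ : ℝ) / (2 * B)) * o₂ ≤ r * o₂ := by gcongr
  have e₃ : (δ : ℝ) / (2 * B) * (o₁ + o₂) ≤ δ := by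
    rw [div_mul_eq_mul_div, div_le_iff₀ (by positivity)]
    have : (o₁ : ℝ) + o₂ ≤ 2 * B := by linarith
    gcongr
  nlinarith

/-! ### Tails of the fair binomial law -/

/-- `binomialTail n i` is the probability of at least `i` heads in `n` tosses of a fair coin. -/
def binomialTail : ℕ → ℕ → ℝ≥0
  | _, 0 => 1
  | 0, _ + 1 => 0
  | n + 1, i + 1 => (binomialTail n i + binomialTail n (i + 1)) / 2

@[simp]
theorem binomialTail_zero_right (n : ℕ) : binomialTail n 0 = 1 := by cases n <;> rfl

theorem binomialTail_succ_succ (n i : ℕ) :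
    binomialTail (n + 1) (i + 1) = (binomialTail n i + binomialTail n (i + 1)) / 2 := rfl

theorem binomialTail_sub (n i : ℕ) :
    (binomialTail n i : ℝ) - binomialTail n (i + 1) = n.choose i / 2 ^ n := by
  induction n generalizing i with
  | zero => cases i <;> simp [binomialTail]
  | succ n ih =>
    cases i with
    | zero =>
      have := ih 0
      simp only [binomialTail_zero_right, binomialTail_succ_succ, Nat.choose_zero_right] at this ⊢
      push_cast at this ⊢
      rw [pow_succ]
      field_simp at this ⊢
      linarith
    | succ i =>
      have h₁ := ih i
      have h₂ := ih (i + 1)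
      rw [binomialTail_succ_succ, binomialTail_succ_succ, Nat.choose_succ_succ]
      push_cast
      rw [pow_succ, ← div_div, add_div _ _ (2 ^ n : ℝ), ← h₁, Nat.succ_eq_add_one, ← h₂]
      ring

theorem binomialTail_antitone (n : ℕ) : Antitone (binomialTail n) := by
  refine antitone_nat_of_succ_le fun i => ?_
  have := binomialTail_sub n i
  have h : (0 : ℝ) ≤ n.choose i / 2 ^ n := by positivity
  rw [← NNReal.coe_le_coe]
  linarith

theorem binomialTail_le_one (n i : ℕ) : binomialTail n i ≤ 1 :=
  (binomialTail_antitone n i.zero_le).trans_eq (binomialTail_zero_right n)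

theorem binomialTail_eq_zero {n i : ℕ} (h : n < i) : binomialTail n i = 0 := by
  induction n generalizing i with
  | zero => obtain ⟨i, rfl⟩ := Nat.exists_eq_add_of_le' h; rfl
  | succ n ih =>
    obtain ⟨i, rfl⟩ := Nat.exists_eq_add_of_le' (Nat.one_le_of_lt h)
    rw [binomialTail_succ_succ, ih (by omega), ih (by omega)]
    simp

/-- Exchanging heads and tails turns "at least `j` heads" into "fewer than `i` heads". -/
theorem binomialTail_symm {n i j : ℕ} (h : i + j = n + 1) :
    binomialTail n i + binomialTail n j = 1 := by
  induction n generalizing i j with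
  | zero =>
    obtain ⟨rfl, rfl⟩ | ⟨rfl, rfl⟩ : i = 0 ∧ j = 1 ∨ i = 1 ∧ j = 0 := by omega
    all_goals simp [binomialTail]
  | succ n ih =>
    rcases i with _ | i
    · rw [binomialTail_eq_zero (i := j) (by omega)]
      simp
    rcases j with _ | j
    · rw [binomialTail_eq_zero (i := i + 1) (by omega)]
      simp
    have h₁ := ih (i := i) (j := j + 1) (by omega)
    have h₂ := ih (i := i + 1) (j := j) (by omega)
    rw [binomialTail_succ_succ, binomialTail_succ_succ, ← add_div,
      show binomialTail n i + binomialTail n (i + 1) + (binomialTail n j + binomialTail n (j + 1))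
        = (binomialTail n i + binomialTail n (j + 1)) +
          (binomialTail n (i + 1) + binomialTail n j) by ring, h₁, h₂]
    norm_num

theorem one_le_two_mul_binomialTail {k i : ℕ} (h : i ≤ k) :
    1 ≤ 2 * binomialTail (2 * k) i := by
  have h₁ := binomialTail_symm (n := 2 * k) (i := k) (j := k + 1) (by omega)
  have h₂ := binomialTail_antitone (2 * k) k.le_succ
  have h₃ := binomialTail_antitone (2 * k) h
  rw [two_mul]
  exact h₁.symm.trans_le (add_le_add h₃ (h₂.trans h₃))

theorem two_mul_binomialTail_le_one {k i : ℕ} (h : k < i) :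
    2 * binomialTail (2 * k) i ≤ 1 := by
  have h₁ := binomialTail_symm (n := 2 * k) (i := k) (j := k + 1) (by omega)
  have h₂ := binomialTail_antitone (2 * k) k.le_succ
  have h₃ := binomialTail_antitone (2 * k) (Nat.succ_le_of_lt h)
  rw [two_mul]
  exact (add_le_add (h₃.trans h₂) h₃).trans_eq h₁

/-- Induction on the ratio of consecutive central binomials; the step is `(2k+1)(2k+3) ≤ 4(k+1)²`.
-/
theorem centralBinom_sq_mul_le (k : ℕ) : k.centralBinom ^ 2 * (2 * k + 1) ≤ 16 ^ k := by
  induction k with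
  | zero => simp
  | succ k ih =>
    have h := Nat.succ_mul_centralBinom_succ k
    refine le_of_mul_le_mul_left ?_ (show 0 < (k + 1) ^ 2 by positivity)
    calc (k + 1) ^ 2 * ((k + 1).centralBinom ^ 2 * (2 * (k + 1) + 1))
        = ((k + 1) * (k + 1).centralBinom) ^ 2 * (2 * k + 3) := by ring
      _ = (k.centralBinom ^ 2 * (2 * k + 1)) * (4 * ((2 * k + 1) * (2 * k + 3))) := by
          rw [h]; ring
      _ ≤ 16 ^ k * (4 * (4 * (k + 1) ^ 2)) :=
          Nat.mul_le_mul ih (Nat.mul_le_mul_left 4 (by nlinarith))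
      _ = (k + 1) ^ 2 * 16 ^ (k + 1) := by ring

theorem binomialTail_sub_le (k i : ℕ) :
    (binomialTail (2 * k) i : ℝ) - binomialTail (2 * k) (i + 1) ≤ 1 / √(2 * k + 1) := by
  rw [binomialTail_sub, div_le_div_iff₀ (by positivity) (by positivity), one_mul]
  have h₁ : ((2 * k).choose i : ℝ) ≤ k.centralBinom := by
    exact_mod_cast Nat.choose_le_centralBinom i k
  have h₂ : ((k.centralBinom : ℝ) * √(2 * k + 1)) ^ 2 ≤ (2 ^ (2 * k)) ^ 2 := by
    rw [mul_pow, Real.sq_sqrt (by positivity), ← pow_mul, mul_comm (2 * k) 2, ← mul_assoc, pow_mul]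
    norm_num
    exact_mod_cast centralBinom_sq_mul_le k
  exact (by gcongr : _ ≤ (k.centralBinom : ℝ) * √(2 * k + 1)).trans
    (abs_le_of_sq_le_sq' h₂ (by positivity)).2

theorem binomialTail_sub_le_mul (k i N : ℕ) :
    (binomialTail (2 * k) i : ℝ) - binomialTail (2 * k) (i + N) ≤ N * (1 / √(2 * k + 1)) := by
  induction N with
  | zero => simp
  | succ N ih =>
    have := binomialTail_sub_le k (i + N)
    rw [← add_assoc]
    push_cast
    linarith

/-! ### Values of the two continuations -/

/-- The expected total value of the best `m` among `n` fair coins on `{0, 2}`. -/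
def coinValue (n m : ℕ) : ℝ≥0 := ∑ i ∈ Finset.range m, 2 * binomialTail n (i + 1)

@[simp]
theorem coinValue_zero_right (n : ℕ) : coinValue n 0 = 0 := by simp [coinValue]

@[simp]
theorem coinValue_zero_left (m : ℕ) : coinValue 0 m = 0 := by simp [coinValue, binomialTail]

theorem coinValue_succ_right (n m : ℕ) :
    coinValue n (m + 1) = coinValue n m + 2 * binomialTail n (m + 1) :=
  Finset.sum_range_succ _ _

/-- Condition on the first coin: a `2` is taken and uses a slot, a `0` is skipped. -/
theorem coinValue_succ_succ (n m : ℕ) :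
    coinValue (n + 1) (m + 1) = 1 + (coinValue n m + coinValue n (m + 1)) / 2 := by
  induction m with
  | zero =>
    simp [coinValue, binomialTail_succ_succ]
    ring
  | succ m ih =>
    rw [coinValue_succ_right, ih, coinValue_succ_right n (m + 1), coinValue_succ_right n m,
      binomialTail_succ_succ]
    rw [← NNReal.coe_inj]
    push_cast
    ring

theorem slotValue_replicate_pure (x : ℝ≥0) {q m : ℕ} (h : m ≤ q) :
    slotValue (List.replicate q (PMF.pure x)) m = (x * m : ℝ≥0) := by
  apply le_antisymm
  · refine (slotValue_le_mul x _ ?_ m).trans_eq (by push_cast; rfl)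
    intro p hp v hv
    rw [List.eq_of_mem_replicate hp] at hv
    simp_all
  · simpa using mul_add_slotValue_le x [] h le_rfl

/-- An extra slot is worth between `0` and `2`, so the optimal rule skips a `0` and takes a `2`. -/
theorem slotValue_fairCoin_cons_of_le {l : List (PMF ℝ≥0)} {m : ℕ} {x y : ℝ≥0}
    (hx : slotValue l m = x) (hy : slotValue l (m + 1) = y) (hxy : x ≤ y) (hyx : y ≤ 2 + x) :
    slotValue (fairCoin :: l) (m + 1) = ((y + (2 + x)) / 2 : ℝ≥0) := by
  rw [slotValue_fairCoin_cons_succ, hx, hy]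
  norm_cast
  rw [max_eq_left hxy, max_eq_right hyx, ENNReal.coe_div two_ne_zero, ENNReal.div_eq_inv_mul]
  push_cast
  ring

theorem slotValue_replicate_fairCoin (n m : ℕ) :
    slotValue (List.replicate n fairCoin) m = coinValue n m := by
  induction n generalizing m with
  | zero => simp
  | succ n ih =>
    cases m with
    | zero => simp
    | succ m =>
      rw [List.replicate_succ, slotValue_fairCoin_cons_of_le (ih m) (ih (m + 1)),
        coinValue_succ_succ]
      · congr 1
        rw [← NNReal.coe_inj]
        push_cast
        ring
      · rw [coinValue_succ_right]
        exact le_self_add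
      · rw [coinValue_succ_right, add_comm]
        gcongr
        simpa using mul_le_mul_right (binomialTail_le_one n (m + 1)) 2

/-- The last of at most `k` slots earns `2 T ≥ 1` from the coins, where `T` is its tail probability,
so spending it on a `1` never helps. -/
theorem slotValue_pure_append_fairCoin {k m : ℕ} (hm : m ≤ k) (q : ℕ) :
    slotValue (List.replicate q (PMF.pure 1) ++ List.replicate (2 * k) fairCoin) m =
      coinValue (2 * k) m := by
  induction q generalizing m with
  | zero => simpa using slotValue_replicate_fairCoin _ _
  | succ q ih =>
    cases m with
    | zero => simp
    | succ m =>
      rw [List.replicate_succ, List.cons_append, slotValue_pure_cons_succ, ih hm, ih (by omega)]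
      norm_cast
      refine max_eq_left ?_
      rw [coinValue_succ_right, add_comm]
      gcongr
      exact one_le_two_mul_binomialTail hm

/-- Since `m ≤ q`, every slot can fall back on a `1`; a coin showing `2` improves on this by `1`,
half of what it contributes to `coinValue`. -/
theorem slotValue_fairCoin_append_pure {m q : ℕ} (hm : m ≤ q) (n : ℕ) :
    slotValue (List.replicate n fairCoin ++ List.replicate q (PMF.pure 1)) m =
      (m + coinValue n m / 2 : ℝ≥0) := by
  induction n generalizing m with
  | zero => simpa using slotValue_replicate_pure 1 hm
  | succ n ih =>
    cases m with
    | zero => simp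
    | succ m =>
      rw [List.replicate_succ, List.cons_append,
        slotValue_fairCoin_cons_of_le (ih (by omega)) (ih hm), coinValue_succ_succ]
      · congr 1
        rw [← NNReal.coe_inj]
        push_cast
        ring
      · rw [coinValue_succ_right, ← NNReal.coe_le_coe]
        push_cast
        have := (binomialTail n (m + 1)).coe_nonneg
        linarith
      · rw [coinValue_succ_right, ← NNReal.coe_le_coe]
        push_cast
        have : (binomialTail n (m + 1) : ℝ) ≤ 1 := binomialTail_le_one n (m + 1)
        linarith

/-- The increments of `coinValue` are twice the tails, which decrease, so the last one bounds all of
them below; in `coinValue_le_add` the first one bounds them above. -/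
theorem coinValue_add_le {n m m' : ℕ} {t : ℝ≥0} (h : m ≤ m') (ht : t ≤ binomialTail n m') :
    (coinValue n m : ℝ) + 2 * t * (m' - m) ≤ coinValue n m' := by
  induction m', h using Nat.le_induction with
  | base => simp
  | succ m' h ih =>
    have := ih (ht.trans (binomialTail_antitone n m'.le_succ))
    have ht' : (t : ℝ) ≤ binomialTail n (m' + 1) := ht
    rw [coinValue_succ_right]
    push_cast
    linarith

theorem coinValue_le_add {n m m' : ℕ} {t : ℝ≥0} (h : m ≤ m')
    (ht : binomialTail n (m + 1) ≤ t) :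
    (coinValue n m' : ℝ) ≤ coinValue n m + 2 * t * (m' - m) := by
  induction m', h using Nat.le_induction with
  | base => simp
  | succ m' h ih =>
    have ht' : (binomialTail n (m' + 1) : ℝ) ≤ t :=
      (binomialTail_antitone n (by omega)).trans ht
    rw [coinValue_succ_right]
    push_cast
    linarith

/-! ### The window of slots on which the orders disagree -/

/-- The tail passes slowly from `27 / 32` to `25 / 32`. -/
theorem exists_binomialTail_window {k N : ℕ} (hN : N ≤ √(2 * k + 1) / 16) :
    ∃ s, s + N ≤ k ∧ binomialTail (2 * k) (s + 1) ≤ 27 / 32 ∧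
      25 / 32 ≤ binomialTail (2 * k) (s + N) := by
  have hex : ∃ s, binomialTail (2 * k) (s + 1) ≤ 27 / 32 :=
    ⟨2 * k, by rw [binomialTail_eq_zero (Nat.lt_succ_self _)]; positivity⟩
  classical
  -- Minimality of `s` gives a tail of at least `27/32` at `s`; over `N` steps it drops by at most
  -- `1/16 = 2/32`.
  have hs := Nat.find_spec hex
  set s := Nat.find hex with hsdef
  have hs' : (27 / 32 : ℝ≥0) ≤ binomialTail (2 * k) s := by
    rcases hs0 : s with _ | j
    · rw [binomialTail_zero_right, ← NNReal.coe_le_coe]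
      norm_num
    · exact le_of_not_ge (Nat.find_min hex (m := j) (by omega))
  have hw := binomialTail_sub_le_mul k s N
  have hNw : (N : ℝ) * (1 / √(2 * k + 1)) ≤ 1 / 16 := by
    rw [mul_one_div, div_le_iff₀ (by positivity)]
    linarith
  have hlow : (25 / 32 : ℝ≥0) ≤ binomialTail (2 * k) (s + N) := by
    rw [← NNReal.coe_le_coe] at hs' ⊢
    push_cast at hs' ⊢
    linarith
  refine ⟨s, ?_, hs, hlow⟩
  -- Beyond `k` the tail is at most `1/2`, less than `25/32`.
  by_contra! hlt
  have h₁ := two_mul_binomialTail_le_one hlt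
  rw [← NNReal.coe_le_coe] at h₁ hlow
  push_cast at h₁ hlow
  linarith

/-- Whatever the number `m` of slots kept after the `a`'s, some slot counts `m₁` for the order
`ABC` and `m₂` for the order `ACB` are better by `N / 32` altogether. -/
theorem exists_better_slots {k N : ℕ} (hN : N ≤ √(2 * k + 1) / 16) (m : ℕ) (hm : m ≤ k) :
    ∃ m₁ ≤ k, ∃ m₂ ≤ k,
      2 * (7 / 4 * (k - m : ℝ)) + coinValue (2 * k) m + (m + coinValue (2 * k) m / 2) + N / 32 ≤
        (7 / 4 * (k - m₁ : ℝ) + coinValue (2 * k) m₁) +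
          (7 / 4 * (k - m₂ : ℝ) + (m₂ + coinValue (2 * k) m₂ / 2)) := by
  obtain ⟨s, hsk, hs, hsN⟩ := exists_binomialTail_window hN
  -- Up to `s + N` a slot earns at least `1 + 25/32 = 7/4 + 1/32` in the order `ACB`; beyond `s` it
  -- earns at most `27/16 = 7/4 - 1/16` in the order `ABC`.
  have up : ∀ m' ≤ s + N, (coinValue (2 * k) m' : ℝ) + 25 / 16 * ((s + N : ℕ) - m') ≤
      coinValue (2 * k) (s + N) := fun m' h => by
    have := coinValue_add_le h hsN
    push_cast at this ⊢
    linarith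
  have down : ∀ m', s ≤ m' → (coinValue (2 * k) m' : ℝ) ≤
      coinValue (2 * k) s + 27 / 16 * (m' - s) := fun m' h => by
    have := coinValue_le_add h hs
    push_cast at this ⊢
    linarith
  have hsk' : (s : ℝ) + N ≤ k := by exact_mod_cast hsk
  have hN0 : (0 : ℝ) ≤ N := N.cast_nonneg
  -- Below the window only `ACB` improves, by raising `m` to `s + N`; above it only `ABC`, by
  -- lowering `m` to `s`. Inside, both moves are made, and together they cover the `N` slots of the
  -- window.
  rcases le_total m s with h₁ | h₁
  · refine ⟨m, hm, s + N, hsk, ?_⟩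
    have := up m (by omega)
    have h₁' : (m : ℝ) ≤ s := by exact_mod_cast h₁
    push_cast at this ⊢
    linarith
  have h₁' : (s : ℝ) ≤ m := by exact_mod_cast h₁
  have hd := down m h₁
  rcases le_total m (s + N) with h₂ | h₂
  · refine ⟨s, by omega, s + N, hsk, ?_⟩
    have hu := up m h₂
    push_cast at hu ⊢
    linarith
  · refine ⟨s, by omega, m, hm, ?_⟩
    have h₂' : (s : ℝ) + N ≤ m := by exact_mod_cast h₂
    linarith

/-! ### The hard instance for large `k` -/

theorem support_fairCoin_le {v : ℝ≥0} (hv : v ∈ fairCoin.support) : v ≤ 2 := by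
  simp only [fairCoin, PMF.support_uniformOfFinset, Finset.coe_insert, Finset.coe_singleton,
    Set.mem_insert_iff, Set.mem_singleton_iff] at hv
  rcases hv with rfl | rfl <;> simp

theorem hardInstance_le_two (k : ℕ) (e : HardElement k) :
    ∀ v ∈ ((hardInstance k).D e).support, v ≤ 2 := by
  rcases e with i | i | i <;> intro v hv
  · obtain rfl : v = 7 / 4 := by simpa [hardInstance] using hv
    rw [← NNReal.coe_le_coe]
    norm_num
  · obtain rfl : v = 1 := by simpa [hardInstance] using hv
    exact one_le_two
  · exact support_fairCoin_le hv

theorem nonDegenerate_hardInstance {k : ℕ} (hk : 1 ≤ k) : (hardInstance k).NonDegenerate :=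
  (hardInstance k).nonDegenerate_of_uniform hk rfl (hardInstance_le_two k) one_pos
    (e := .inr (.inl ⟨0, hk⟩)) rfl

theorem map_D_listA (k : ℕ) :
    (listA k).map (hardInstance k).D = List.replicate k (PMF.pure (7 / 4)) := by
  rw [listA, List.map_map, List.eq_replicate_iff]
  simp [hardInstance]

theorem map_D_listB (k : ℕ) :
    (listB k).map (hardInstance k).D = List.replicate k (PMF.pure 1) := by
  rw [listB, List.map_map, List.eq_replicate_iff]
  simp [hardInstance]

theorem map_D_listC (k : ℕ) :
    (listC k).map (hardInstance k).D = List.replicate (2 * k) fairCoin := by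
  rw [listC, List.map_map, List.eq_replicate_iff]
  simp [hardInstance, fairCoin]

theorem hardInstance_expectedUtility_add_le {k N : ℕ} (hN : N ≤ √(2 * k + 1) / 16)
    {A : Algorithm (HardElement k)} (hA : (hardInstance k).IsOrderUnaware A) :
    (hardInstance k).expectedUtility A (orderABC k) +
        (hardInstance k).expectedUtility A (orderACB k) + (N / 32 : ℝ≥0) ≤
      (hardInstance k).opt (orderABC k) + (hardInstance k).opt (orderACB k) := by
  refine (hardInstance k).expectedUtility_add_le rfl hA (l := listA k) rfl rfl (x := 7 / 4)
    (fun e he => ?_) fun s m hsm => ?_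
  · obtain ⟨i, -, rfl⟩ := List.mem_map.1 he
    rfl
  -- The optima are bounded below by selecting `k - m₁`, respectively `k - m₂`, of the `a`'s.
  obtain ⟨m₁, h₁, m₂, h₂, hle⟩ := exists_better_slots hN m (by omega)
  rw [Instance.opt_eq_slotValue _ rfl, Instance.opt_eq_slotValue _ rfl]
  have e₁ := mul_add_slotValue_le (7 / 4)
    ((listB k ++ listC k).map (hardInstance k).D) (Nat.sub_le k m₁) (Nat.sub_le k m₁)
  have e₂ := mul_add_slotValue_le (7 / 4)
    ((listC k ++ listB k).map (hardInstance k).D) (Nat.sub_le k m₂) (Nat.sub_le k m₂)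
  rw [← map_D_listA, ← List.map_append, Nat.sub_sub_self h₁] at e₁
  rw [← map_D_listA, ← List.map_append, Nat.sub_sub_self h₂] at e₂
  refine le_trans ?_ (add_le_add e₁ e₂)
  rw [List.map_append, List.map_append, map_D_listB, map_D_listC,
    slotValue_pure_append_fairCoin (by omega), slotValue_pure_append_fairCoin h₁,
    slotValue_fairCoin_append_pure (by omega), slotValue_fairCoin_append_pure h₂]
  obtain ⟨j₁, hj₁⟩ := Nat.exists_eq_add_of_le h₁
  obtain ⟨j₂, hj₂⟩ := Nat.exists_eq_add_of_le h₂
  rw [show k - m₁ = j₁ by omega, show k - m₂ = j₂ by omega]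
  norm_cast
  rw [← NNReal.coe_le_coe]
  push_cast
  have hs : (s : ℝ) + m = k := by exact_mod_cast hsm
  have hj₁' : (k : ℝ) = m₁ + j₁ := by exact_mod_cast hj₁
  have hj₂' : (k : ℝ) = m₂ + j₂ := by exact_mod_cast hj₂
  linarith

theorem hardInstance_min_ratio_le {k : ℕ} (hk : 1024 ≤ k) {A : Algorithm (HardElement k)}
    (hA : (hardInstance k).IsOrderUnaware A) :
    min ((hardInstance k).ratio A (orderABC k)) ((hardInstance k).ratio A (orderACB k)) ≤
      ENNReal.ofReal (1 - 1 / 4096 / √(k : ℝ)) := by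
  set N := ⌊√(2 * k + 1) / 16⌋₊ with hN
  have hle : ∀ π, (hardInstance k).opt π ≤ (2 * k : ℝ≥0) := fun π => by
    simpa using (hardInstance k).opt_le_mul rfl (hardInstance_le_two k) π
  have hnd := nonDegenerate_hardInstance (k := k) (by omega)
  have hk' : (1024 : ℝ) ≤ k := by exact_mod_cast hk
  refine (min_div_le (B := 2 * k) (by positivity) (hnd _).1 (hnd _).1 (hle _) (hle _)
    (hardInstance_expectedUtility_add_le (Nat.floor_le (by positivity)) hA)).trans ?_
  apply ENNReal.ofReal_le_ofReal
  -- From `√k ≥ 32`, `N ≥ √k/16 - 1 ≥ √k/32`. The relative loss `(N/32) / (4k)` is then at least `1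
  -- / (4096 √k)`.
  have hr : 32 ≤ √(k : ℝ) := Real.le_sqrt_of_sq_le (by linarith)
  have hr2 : √(k : ℝ) * √k = k := Real.mul_self_sqrt (by linarith)
  have hr' : √(k : ℝ) ≤ √(2 * k + 1) := Real.sqrt_le_sqrt (by linarith)
  have hfl := Nat.lt_floor_add_one (√(2 * (k : ℝ) + 1) / 16)
  rw [← hN] at hfl
  have hNk : √(k : ℝ) / 32 ≤ N := by linarith
  push_cast
  suffices h : 1 / 4096 / √(k : ℝ) ≤ N / 32 / (2 * (2 * k)) by linarith
  rw [div_le_div_iff₀ (by positivity) (by positivity)]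
  nlinarith

/-! ### An instance for small `k` -/

/-- The elements of an instance that is hard for small `k`: `k` copies of `a`, one `b`, one `c`. -/
abbrev SmallElement (k : ℕ) : Type := Fin k ⊕ Bool

/-- Each `a` has value `5/4`, `b` has value `1`, and `c` is a fair coin on `{0, 2}`. -/
def smallInstance (k : ℕ) : Instance (SmallElement k) where
  D
    | .inl _ => PMF.pure (5 / 4)
    | .inr true => PMF.pure 1
    | .inr false => fairCoin
  F := uniformConstraint (SmallElement k) k
  F_nonempty := ⟨∅, by simp [uniformConstraint]⟩

/-- The order in which the `a`'s arrive first, then `b` and `c` (or `c` and `b`). -/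
def smallOrder (k : ℕ) (b : Bool) : ArrivalOrder (SmallElement k) where
  toList := (List.finRange k).map Sum.inl ++ [Sum.inr b, Sum.inr !b]
  nodup := by
    refine ((List.nodup_finRange k).map Sum.inl_injective).append (by simp) ?_
    intro x hx hy
    obtain ⟨i, -, rfl⟩ := List.mem_map.1 hx
    simp at hy
  mem := by
    rintro (i | i)
    · simp
    · cases b <;> cases i <;> simp

theorem map_D_smallOrder (k : ℕ) :
    ((List.finRange k).map Sum.inl).map (smallInstance k).D =
      List.replicate k (PMF.pure (5 / 4)) := by
  rw [List.map_map, List.eq_replicate_iff]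
  simp [smallInstance]

theorem smallInstance_le_two (k : ℕ) (e : SmallElement k) :
    ∀ v ∈ ((smallInstance k).D e).support, v ≤ 2 := by
  rcases e with i | (_ | _) <;> intro v hv
  · obtain rfl : v = 5 / 4 := by simpa [smallInstance] using hv
    rw [← NNReal.coe_le_coe]
    norm_num
  · exact support_fairCoin_le hv
  · obtain rfl : v = 1 := by simpa [smallInstance] using hv
    exact one_le_two

theorem nonDegenerate_smallInstance {k : ℕ} (hk : 1 ≤ k) : (smallInstance k).NonDegenerate :=
  (smallInstance k).nonDegenerate_of_uniform hk rfl (smallInstance_le_two k) one_pos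
    (e := .inr true) rfl

theorem slotValue_pure (x : ℝ≥0) (m : ℕ) : slotValue [PMF.pure x] (m + 1) = x := by
  simp [slotValue_pure_cons_succ]

theorem slotValue_fairCoin (m : ℕ) : slotValue [fairCoin] (m + 1) = (1 : ℝ≥0) := by
  rw [slotValue_fairCoin_cons_of_le (x := 0) (y := 0) (by simp) (by simp) le_rfl (by simp)]
  norm_num

theorem slotValue_pure_fairCoin_one : slotValue [PMF.pure 1, fairCoin] 1 = (1 : ℝ≥0) := by
  rw [slotValue_pure_cons_succ, slotValue_fairCoin]
  simp

theorem slotValue_pure_fairCoin (m : ℕ) :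
    slotValue [PMF.pure 1, fairCoin] (m + 2) = (2 : ℝ≥0) := by
  rw [slotValue_pure_cons_succ, slotValue_fairCoin, slotValue_fairCoin]
  norm_cast

theorem slotValue_fairCoin_pure_one : slotValue [fairCoin, PMF.pure 1] 1 = (3 / 2 : ℝ≥0) := by
  rw [slotValue_fairCoin_cons_of_le (x := 0) (y := 1) (by simp) (slotValue_pure 1 0) (by simp)
    (by norm_num)]
  norm_num

theorem slotValue_fairCoin_pure (m : ℕ) :
    slotValue [fairCoin, PMF.pure 1] (m + 2) = (2 : ℝ≥0) := by
  rw [slotValue_fairCoin_cons_of_le (slotValue_pure 1 m) (slotValue_pure 1 (m + 1)) le_rfl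
    (by simp)]
  norm_num

theorem smallInstance_expectedUtility_add_le {k : ℕ} (hk : 1 ≤ k)
    {A : Algorithm (SmallElement k)} (hA : (smallInstance k).IsOrderUnaware A) :
    (smallInstance k).expectedUtility A (smallOrder k true) +
        (smallInstance k).expectedUtility A (smallOrder k false) + (1 / 4 : ℝ≥0) ≤
      (smallInstance k).opt (smallOrder k true) + (smallInstance k).opt (smallOrder k false) := by
  -- The first free slot is worth `1` if `b` precedes `c` and `3/2` if `c` precedes `b`, while it
  -- costs `5/4`. So `0` slots are kept in one order and `1` in the other, and any common choice
  -- loses at least `1/4` in total.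
  have e₁ := mul_add_slotValue_le (5 / 4) [PMF.pure 1, fairCoin] (le_refl k) (le_refl k)
  have e₂ := mul_add_slotValue_le (5 / 4) [fairCoin, PMF.pure 1] (Nat.sub_le k 1) (Nat.sub_le k 1)
  rw [← map_D_smallOrder] at e₁ e₂
  rw [Nat.sub_self, slotValue_zero] at e₁
  rw [Nat.sub_sub_self hk, slotValue_fairCoin_pure_one] at e₂
  have o₁ : (smallInstance k).opt (smallOrder k true) = slotValue (((List.finRange k).map
      Sum.inl).map (smallInstance k).D ++ [PMF.pure 1, fairCoin]) k := by
    rw [Instance.opt_eq_slotValue _ rfl, smallOrder, List.map_append]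
    rfl
  have o₂ : (smallInstance k).opt (smallOrder k false) = slotValue (((List.finRange k).map
      Sum.inl).map (smallInstance k).D ++ [fairCoin, PMF.pure 1]) k := by
    rw [Instance.opt_eq_slotValue _ rfl, smallOrder, List.map_append]
    rfl
  rw [← o₁] at e₁
  rw [← o₂] at e₂
  refine (smallInstance k).expectedUtility_add_le rfl hA (l := (List.finRange k).map Sum.inl)
    rfl rfl (x := 5 / 4) (fun e he => ?_) fun s m hsm => le_trans ?_ (add_le_add e₁ e₂)
  · obtain ⟨i, -, rfl⟩ := List.mem_map.1 he
    rfl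
  change 2 * _ + slotValue [PMF.pure 1, fairCoin] m + slotValue [fairCoin, PMF.pure 1] m + _ ≤ _
  obtain ⟨j, rfl⟩ := Nat.exists_eq_add_of_le' hk
  rw [Nat.add_sub_cancel]
  have hs : (s : ℝ) + m = j + 1 := by exact_mod_cast hsm
  rcases m with _ | _ | m
  · simp only [slotValue_zero]
    norm_cast
    rw [← NNReal.coe_le_coe]
    push_cast at hs ⊢
    linarith
  · rw [zero_add, slotValue_pure_fairCoin_one, slotValue_fairCoin_pure_one]
    norm_cast
    rw [← NNReal.coe_le_coe]
    push_cast at hs ⊢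
    linarith
  · rw [add_assoc m, slotValue_pure_fairCoin, slotValue_fairCoin_pure]
    norm_cast
    rw [← NNReal.coe_le_coe]
    push_cast at hs ⊢
    have := m.cast_nonneg (α := ℝ)
    linarith

theorem smallInstance_orderCompetitiveRatio_le {k : ℕ} (hk : 1 ≤ k)
    {A : Algorithm (SmallElement k)} (hA : (smallInstance k).IsOrderUnaware A) :
    (smallInstance k).orderCompetitiveRatio A ≤ ENNReal.ofReal (1 - 1 / (16 * k)) := by
  have hle : ∀ π, (smallInstance k).opt π ≤ (2 * k : ℝ≥0) := fun π => by
    simpa using (smallInstance k).opt_le_mul rfl (smallInstance_le_two k) π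
  have hnd := nonDegenerate_smallInstance hk
  refine le_trans (le_min (iInf_le _ (smallOrder k true)) (iInf_le _ (smallOrder k false))) ?_
  refine (min_div_le (B := 2 * k) (by positivity) (hnd _).1 (hnd _).1 (hle _) (hle _)
    (smallInstance_expectedUtility_add_le hk hA)).trans_eq ?_
  congr 2
  push_cast
  field_simp
  norm_num

end

/-! ### Combining the two ranges of `k` -/

theorem theorem5p1 :
    ∃ c : ℝ, 0 < c ∧
      (∀ k : ℕ, 1 ≤ k →
        ∃ (E : Type) (_ : Fintype E) (_ : DecidableEq E) (I : Instance E),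
          I.F = uniformConstraint E k ∧ I.NonDegenerate ∧
          ∀ A : Algorithm E, I.IsOrderUnaware A →
            I.orderCompetitiveRatio A ≤ ENNReal.ofReal (1 - c / √(k : ℝ))) ∧
      (∃ k₀ : ℕ, ∀ k : ℕ, k₀ ≤ k →
        (hardInstance k).NonDegenerate ∧
        ∀ A : Algorithm (HardElement k), (hardInstance k).IsOrderUnaware A →
          min ((hardInstance k).ratio A (orderABC k)) ((hardInstance k).ratio A (orderACB k)) ≤
            ENNReal.ofReal (1 - c / √(k : ℝ))) := by
  refine ⟨1 / 4096, by norm_num, fun k hk => ?_, 1024, fun k hk =>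
    ⟨nonDegenerate_hardInstance (by omega), fun A hA => hardInstance_min_ratio_le hk hA⟩⟩
  rcases le_total 1024 k with h | h
  · exact ⟨HardElement k, inferInstance, inferInstance, hardInstance k, rfl,
      nonDegenerate_hardInstance hk, fun A hA =>
        (le_min (iInf_le _ (orderABC k)) (iInf_le _ (orderACB k))).trans
          (hardInstance_min_ratio_le h hA)⟩
  · refine ⟨SmallElement k, inferInstance, inferInstance, smallInstance k, rfl,
      nonDegenerate_smallInstance hk, fun A hA =>
        (smallInstance_orderCompetitiveRatio_le hk hA).trans (ENNReal.ofReal_le_ofReal ?_)⟩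
    have hk' : (1 : ℝ) ≤ k := by exact_mod_cast hk
    have h' : (k : ℝ) ≤ 1024 := by exact_mod_cast h
    have hr : √(k : ℝ) ≤ 32 := Real.sqrt_le_iff.2 ⟨by norm_num, by linarith⟩
    have hr0 : 0 < √(k : ℝ) := Real.sqrt_pos.2 (by linarith)
    have hr2 : √(k : ℝ) * √k = k := Real.mul_self_sqrt (by linarith)
    -- This amounts to `√k ≤ 256`, which `k ≤ 1024` more than ensures.
    suffices h : 1 / 4096 / √(k : ℝ) ≤ 1 / (16 * k) by linarith
    rw [div_le_div_iff₀ hr0 (by positivity)]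
    nlinarith
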